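/- Let $d\ge 2$ be an integer. In the $\mathrm{Greedy}[d]$ process, balls are placed one after another into $n$ initially empty bins: each ball samples $d$ bins independently and uniformly at random (with replacement) and is put into a least loaded one of the sampled bins, ties being broken according to a fixed ordering of the bins. There are constants $\alpha,\gamma\in\mathbb R$, depending only on $d$ (so universal constants for the two-choice process $d=2$), such that for every $n\ge 3$ and every number $m\ge 0$ of balls, the gap $G$ between the maximum load and the average load $m/n$ after $m$ balls satisfies $$\mathbb E[G]\;\le\;\log_d\log_2 n+\alpha\log_2\log_2\log_2 n+\gamma .$$ In particular, for the two-choice process, writing $\log$ for $\log_2$ and $G^t$ for the gap after $tn$ balls, $\mathbb E[G^t]\le \log\log n+\alpha\log\log\log n+\gamma$ for all $t\ge 0$, with no lower bound on $t$ needed. -/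

import Mathlib

namespace BalancedAllocations

variable {n d : ℕ}

/-- The bin into which the Greedy process puts a ball, when the current loads of the `n` bins are
`x` and the ball has sampled the `d` bins `s 0, …, s (d - 1)` (repetitions allowed): a least loaded
one of the sampled bins, ties being broken by the fixed ordering of the bins. It is the bin
component of the lexicographic minimum of the pairs (load, bin) over the sampled bins. -/
def greedyBin [NeZero d] (x : Fin n → ℕ) (s : Fin d → Fin n) : Fin n :=
  (ofLex (Finset.univ.inf' ⟨0, Finset.mem_univ 0⟩
    fun j : Fin d => toLex (x (s j), s j))).2

/-- The loads of the `n` bins after `m` balls have been placed one after another by Greedy, all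
bins being empty at the start; `ω k` lists the `d` bins sampled by ball number `k`. -/
def loads [NeZero d] : (m : ℕ) → (Fin m → Fin d → Fin n) → Fin n → ℕ
  | 0, _ => fun _ => 0
  | m + 1, ω =>
    let x := loads m (Fin.init ω)
    let b := greedyBin x (ω (Fin.last m))
    Function.update x b (x b + 1)

/-- The gap of the allocation: maximum load minus average load, after `m` balls. -/
noncomputable def gap [NeZero d] (m : ℕ) (ω : Fin m → Fin d → Fin n) : ℝ :=
  ((Finset.univ.sup (loads m ω) : ℕ) : ℝ) - (m : ℝ) / n

/-- The expected gap after `m` balls. The `m * d` samples are independent and uniform over the `n`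
bins, that is, `ω` is uniform over the finite set of all functions `Fin m → Fin d → Fin n`. -/
noncomputable def expectedGap (n d : ℕ) [NeZero d] (m : ℕ) : ℝ :=
  (∑ ω : Fin m → Fin d → Fin n, gap m ω) / Fintype.card (Fin m → Fin d → Fin n)

end BalancedAllocations

/-!
The expected gap of `Greedy[d]` is bounded by a potential function argument followed by two rounds
of layered induction. The process is a Markov chain on load vectors, and everything is expressed
through the powers of its transition operator `markov n d`.

*Exponential potential.* Let `Γ x = ∑ i, (exp (a * y i) + exp (-a * y i))`, where `y i` is the load
of bin `i` minus the average load and `a` is a small constant. A ball goes to a bin at most as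
loaded as its first two samples, so, to first order in `a`, the expected change of `Γ` in one step
is at most `-a / 2` times the sum of the mean absolute differences of the families `exp (a * y i)`
and `exp (-a * y i)`. As the `y i` have mean zero, these differences control the mean of the two
families themselves (`sum_exp_add_sum_exp_neg_le`). Hence `Γ` has negative drift once it exceeds a
multiple of `n`, and its expectation is `O(n)` at all times (`markov_pow_potential_le`). In
particular the gap has an exponential tail on the scale `log n`, and the expected number of bins
whose load exceeds the average by `ℓ` is at most `O(n * exp (-a * ℓ))`.

*Gap reduction.* Suppose that the gap was at most `L` when the last `L * n` balls were still to
come. Then no load exceeded the final average, and every bin above a level higher than that was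
lifted there by one of the last `L * n` balls. A ball lifts a bin above level `h` only if all its
`d` samples have load at least `h`, so if a fraction `β` of the bins reaches level `h`, at most
about `L * β ^ d * n` bins reach level `h + 1`.
The starting fraction, at `O(log L)` above the average, is of order `1 / L` by the bound on `Γ`, and
the fractions then decrease doubly exponentially, vanishing after `log_d log₂ n` levels. This
decrease is so fast that Markov's inequality with failure probability `δ / 2 ^ i` at level `i`
suffices (`markov_pow_sup_ge_le_of_pow`, `gapTail_le_add`).

Thus a tail of the gap on the scale `Y`, uniform in time, yields a tail around
`log_d log₂ n + O(log Y)` (`gapTail_le_exp_neg`). With `Y = log₂ n` this gives the scale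
`log₂ log₂ n`; a second application then gives the error term `O(log log log n)` with an
exponential tail of constant scale, which is summed.
-/

open Finset
open scoped BigOperators

namespace BalancedAllocations

variable {n d : ℕ}

/-! ### The allocation process as a Markov chain -/

/-- The loads after one more ball, with samples `s`, has been placed on top of the loads `x`. -/
def step [NeZero d] (x : Fin n → ℕ) (s : Fin d → Fin n) : Fin n → ℕ :=
  Function.update x (greedyBin x s) (x (greedyBin x s) + 1)

lemma load_greedyBin_le [NeZero d] (x : Fin n → ℕ) (s : Fin d → Fin n) (j : Fin d) :
    x (greedyBin x s) ≤ x (s j) := by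
  obtain ⟨k, -, hk⟩ := exists_mem_eq_inf' (s := (univ : Finset (Fin d))) ⟨0, mem_univ 0⟩
    (fun j : Fin d => toLex (x (s j), s j))
  have h := inf'_le (s := (univ : Finset (Fin d))) (fun j : Fin d => toLex (x (s j), s j))
    (mem_univ j)
  rw [hk, Prod.Lex.toLex_le_toLex] at h
  have hb : greedyBin x s = s k := by rw [greedyBin, hk]; rfl
  rw [hb]
  rcases h with h | h
  · exact h.le
  · exact h.1.le

/-- The sum of a function of the loads changes in one summand only. -/
lemma sum_step [NeZero d] (x : Fin n → ℕ) (s : Fin d → Fin n) {M : Type*} [AddCommGroup M]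
    (f : ℕ → M) :
    ∑ i, f (step x s i) = ∑ i, f (x i) +
      (f (x (greedyBin x s) + 1) - f (x (greedyBin x s))) := by
  rw [← add_sum_erase univ (fun i => f (step x s i)) (mem_univ (greedyBin x s)),
    ← add_sum_erase univ (fun i => f (x i)) (mem_univ (greedyBin x s)),
    sum_congr rfl (g := fun i => f (x i))
      (fun i hi => by simp [step, Function.update_of_ne (ne_of_mem_erase hi)])]
  simp only [step, Function.update_self]
  abel

lemma sum_load_step [NeZero d] (x : Fin n → ℕ) (s : Fin d → Fin n) :
    ∑ i, step x s i = ∑ i, x i + 1 := by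
  have h := sum_step x s (fun k => (k : ℤ))
  push_cast at h
  have h' : ((∑ i, step x s i : ℕ) : ℤ) = ((∑ i, x i + 1 : ℕ) : ℤ) := by
    push_cast
    linarith
  exact_mod_cast h'

lemma le_step [NeZero d] (x : Fin n → ℕ) (s : Fin d → Fin n) : x ≤ step x s := by
  intro i
  unfold step
  rcases eq_or_ne i (greedyBin x s) with rfl | h
  · simp
  · simp [h]

/-- The transition operator of the process: `markov n d f x` is the expected value of `f` one ball
after the loads were `x`. -/
noncomputable def markov (n d : ℕ) [NeZero d] :
    Module.End ℝ ((Fin n → ℕ) → ℝ) where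
  toFun f x := 𝔼 s : Fin d → Fin n, f (step x s)
  map_add' f g := by
    funext x
    simp [expect_add_distrib]
  map_smul' c f := by
    funext x
    simp [mul_expect]

lemma markov_apply [NeZero d] (f : (Fin n → ℕ) → ℝ) (x : Fin n → ℕ) :
    markov n d f x = 𝔼 s : Fin d → Fin n, f (step x s) := rfl

lemma markov_const [NeZero n] [NeZero d] (c : ℝ) :
    markov n d (fun _ => c) = fun _ => c := by
  funext x
  simp [markov_apply]

lemma markov_pow_succ [NeZero d] (m : ℕ) (f : (Fin n → ℕ) → ℝ) :
    (markov n d ^ (m + 1)) f = (markov n d ^ m) (markov n d f) := by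
  rw [pow_succ, Module.End.mul_apply]

lemma markov_pow_succ' [NeZero d] (m : ℕ) (f : (Fin n → ℕ) → ℝ) :
    (markov n d ^ (m + 1)) f = markov n d ((markov n d ^ m) f) := by
  rw [pow_succ', Module.End.mul_apply]

lemma markov_pow_const [NeZero n] [NeZero d] (m : ℕ) (c : ℝ) :
    (markov n d ^ m) (fun _ => c) = fun _ => c := by
  induction m with
  | zero => rfl
  | succ m ih => rw [markov_pow_succ, markov_const, ih]

/-- Monotonicity of the transition operator, in the form that only requires the inequality for
the load vectors with the right number of balls. -/
lemma markov_pow_mono_of_sum [NeZero d] (m : ℕ) {f g : (Fin n → ℕ) → ℝ} (x : Fin n → ℕ)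
    (h : ∀ y, ∑ i, y i = ∑ i, x i + m → f y ≤ g y) :
    (markov n d ^ m) f x ≤ (markov n d ^ m) g x := by
  induction m generalizing x with
  | zero => exact h x rfl
  | succ m ih =>
    rw [markov_pow_succ', markov_pow_succ', markov_apply, markov_apply]
    refine expect_le_expect fun s _ => ih _ fun y hy => h y ?_
    rw [hy, sum_load_step]
    ring

lemma markov_pow_mono [NeZero d] (m : ℕ) {f g : (Fin n → ℕ) → ℝ} (h : f ≤ g) :
    (markov n d ^ m) f ≤ (markov n d ^ m) g :=
  fun x => markov_pow_mono_of_sum m x fun y _ => h y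

/-- An additive drift bound for one step adds up over `m` steps. -/
lemma markov_pow_le_add [NeZero n] [NeZero d] (m : ℕ) {f : (Fin n → ℕ) → ℝ} {c : ℝ}
    (h : ∀ x, markov n d f x ≤ f x + c) (x : Fin n → ℕ) :
    (markov n d ^ m) f x ≤ f x + m * c := by
  induction m with
  | zero => simp
  | succ m ih =>
    rw [markov_pow_succ]
    have h1 := markov_pow_mono m (d := d) (show markov n d f ≤ f + fun _ => c from h) x
    rw [map_add, markov_pow_const] at h1
    push_cast
    simp only [Pi.add_apply] at h1
    linarith

lemma expect_cons {ι : Type*} [Fintype ι] {k : ℕ} (f : (Fin (k + 1) → ι) → ℝ) :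
    𝔼 s : Fin (k + 1) → ι, f s = 𝔼 i : ι, 𝔼 s : Fin k → ι, f (Fin.cons i s) := by
  rw [← Fintype.expect_equiv (Fin.consEquiv fun _ : Fin (k + 1) => ι)
    (fun p => f (Fin.cons p.1 p.2)) f (fun _ => rfl), ← univ_product_univ, expect_product]

lemma expect_snoc {ι : Type*} [Fintype ι] {k : ℕ} (f : (Fin (k + 1) → ι) → ℝ) :
    𝔼 s : Fin (k + 1) → ι, f s =
      𝔼 s : Fin k → ι, 𝔼 i : ι, f (Fin.snoc (α := fun _ => ι) s i) := by
  rw [← Fintype.expect_equiv (Fin.snocEquiv fun _ : Fin (k + 1) => ι)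
    (fun p => f (Fin.snoc (α := fun _ => ι) p.2 p.1)) f (fun _ => rfl), ← univ_product_univ,
    expect_product, expect_comm]

lemma loads_snoc [NeZero d] (m : ℕ) (ω : Fin m → Fin d → Fin n) (s : Fin d → Fin n) :
    loads (m + 1) (Fin.snoc (α := fun _ => Fin d → Fin n) ω s) = step (loads m ω) s := by
  simp only [loads, step, Fin.init_snoc, Fin.snoc_last]

lemma expect_loads [NeZero d] (m : ℕ) (f : (Fin n → ℕ) → ℝ) :
    𝔼 ω : Fin m → Fin d → Fin n, f (loads m ω) = (markov n d ^ m) f 0 := by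
  induction m generalizing f with
  | zero => simp [loads]; rfl
  | succ m ih =>
    rw [expect_snoc, markov_pow_succ, ← ih]
    simp only [loads_snoc, markov_apply]

lemma sum_loads [NeZero d] (m : ℕ) (ω : Fin m → Fin d → Fin n) : ∑ i, loads m ω i = m := by
  induction m with
  | zero => simp [loads]
  | succ m ih =>
    rw [← Fin.snoc_init_self ω, loads_snoc, sum_load_step, ih]

/-- Maximum load minus average load, as a function of the load vector. -/
noncomputable def loadGap (x : Fin n → ℕ) : ℝ :=
  ((univ.sup x : ℕ) : ℝ) - (∑ i, x i : ℕ) / n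

lemma expectedGap_eq [NeZero d] (m : ℕ) :
    expectedGap n d m = (markov n d ^ m) loadGap 0 := by
  rw [← expect_loads, Fintype.expect_eq_sum_div_card]
  simp only [expectedGap, gap, loadGap, sum_loads]

/-- The probability that the gap exceeds `y` after `m` balls. -/
noncomputable def gapTail (n d : ℕ) [NeZero d] (m : ℕ) (y : ℝ) : ℝ :=
  (markov n d ^ m) (fun x => if y < loadGap x then 1 else 0) 0

/-- Sampling `d ≥ 2` bins and looking at the first two of them only. -/
lemma expect_first_two [NeZero n] (hd : 2 ≤ d) (g : Fin n → Fin n → ℝ) :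
    𝔼 s : Fin d → Fin n, g (s ⟨0, by omega⟩) (s ⟨1, by omega⟩) = 𝔼 i, 𝔼 j, g i j := by
  obtain ⟨k, rfl⟩ := Nat.exists_eq_add_of_le' hd
  rw [expect_cons]
  refine expect_congr rfl fun i _ => ?_
  rw [expect_cons]
  refine expect_congr rfl fun j _ => ?_
  exact Fintype.expect_const (ι := Fin k → Fin n) (g i j)

/-! ### An inequality for mean absolute differences -/

section MeanDifference

variable {ι : Type*} [Fintype ι]

/-- One half of `sum_exp_add_sum_exp_neg_le`. If a quarter of the `exp (u i)` are at most half of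
their mean, these alone give a large mean difference. Otherwise `u` is large at three quarters of
the points, so, its sum being zero, it is very negative at the others, and `∑ exp (-u)` would
exceed `∑ exp u`. -/
lemma sum_exp_le_of_sum_exp_neg_le (u : ι → ℝ) (hu : ∑ i, u i = 0)
    (h : ∑ i, Real.exp (-u i) ≤ ∑ i, Real.exp (u i)) :
    Fintype.card ι * ∑ i, Real.exp (u i) ≤
      8 * ∑ i, ∑ j, |Real.exp (u i) - Real.exp (u j)| +
        2 * Real.exp 4 * (Fintype.card ι : ℝ) ^ 2 := by
  set N : ℝ := (Fintype.card ι : ℝ) with hN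
  set S := ∑ i, Real.exp (u i) with hS
  have hD : 0 ≤ ∑ i, ∑ j, |Real.exp (u i) - Real.exp (u j)| := by positivity
  have hN0 : 0 ≤ N := by positivity
  by_cases hsmall : S ≤ 2 * Real.exp 4 * N
  · have := mul_le_mul_of_nonneg_left hsmall hN0
    nlinarith
  push Not at hsmall
  have hNpos : 0 < N := by
    rcases hN0.lt_or_eq with h0 | h0
    · exact h0
    · have : IsEmpty ι := Fintype.card_eq_zero_iff.mp (Nat.cast_eq_zero.mp (hN.symm.trans h0.symm))
      simp [hS, hN] at hsmall
  set w := Real.log (S / (2 * N)) with hw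
  have hSpos : 0 < S := lt_of_le_of_lt (by positivity) hsmall
  have hew : Real.exp w = S / (2 * N) := Real.exp_log (by positivity)
  have hSw : S = 2 * N * Real.exp w := by
    rw [hew]
    field_simp
  have hw4 : 4 < w := by
    rw [← Real.exp_lt_exp, hew, lt_div_iff₀ (by positivity)]
    linarith
  classical
  set A := univ.filter fun i => u i ≤ w with hA
  by_cases hcard : N ≤ 4 * (#A : ℝ)
  · -- the pairs with second index in `A`
    have h1 : (#A : ℝ) * (S / 2) ≤ ∑ i, ∑ j, |Real.exp (u i) - Real.exp (u j)| := by
      rw [sum_comm]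
      calc (#A : ℝ) * (S / 2) = ∑ j ∈ A, S / 2 := by simp
        _ ≤ ∑ j ∈ A, ∑ i, |Real.exp (u i) - Real.exp (u j)| := by
            refine sum_le_sum fun j hj => ?_
            have hj' : Real.exp (u j) ≤ Real.exp w :=
              Real.exp_le_exp.mpr (mem_filter.mp hj).2
            calc S / 2 = ∑ i, (Real.exp (u i) - Real.exp w) := by
                  rw [sum_sub_distrib, ← hS]
                  simp only [sum_const, card_univ, nsmul_eq_mul, ← hN]
                  linarith
              _ ≤ _ := sum_le_sum fun i _ => by
                  have := le_abs_self (Real.exp (u i) - Real.exp (u j))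
                  linarith
        _ ≤ _ := sum_le_univ_sum_of_nonneg fun j => by positivity
    have h2 := mul_le_mul_of_nonneg_right hcard hSpos.le
    have : 0 ≤ 2 * Real.exp 4 * N ^ 2 := by positivity
    linarith
  · push Not at hcard
    exfalso
    -- tangent line to `exp` at `2 * w`
    have h1 : Real.exp (2 * w) * ∑ i ∈ A, (1 - u i - 2 * w) ≤ ∑ i, Real.exp (-u i) := by
      rw [mul_sum]
      refine (sum_le_sum fun i _ => ?_).trans
        (sum_le_univ_sum_of_nonneg (s := A) fun i => (Real.exp_pos _).le)
      have := Real.add_one_le_exp (-u i - 2 * w)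
      calc Real.exp (2 * w) * (1 - u i - 2 * w)
          ≤ Real.exp (2 * w) * Real.exp (-u i - 2 * w) := by gcongr; linarith
        _ = Real.exp (-u i) := by rw [← Real.exp_add]; ring_nf
    have h2 : ∑ i ∈ A, u i ≤ -((N - #A) * w) := by
      have h3 : ∑ i ∈ A, u i + ∑ i ∈ Aᶜ, u i = 0 := by rw [sum_add_sum_compl, hu]
      have h4 : (#Aᶜ : ℝ) * w ≤ ∑ i ∈ Aᶜ, u i := by
        rw [← nsmul_eq_mul]
        refine card_nsmul_le_sum _ _ _ fun i hi => ?_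
        simp only [hA, mem_compl, mem_filter, mem_univ, true_and, not_le] at hi
        exact hi.le
      have h5 : (#Aᶜ : ℝ) = N - #A := by
        rw [card_compl, Nat.cast_sub (card_le_univ A)]
      rw [h5] at h4
      linarith
    have h3 : N ≤ ∑ i ∈ A, (1 - u i - 2 * w) := by
      have : ∑ i ∈ A, (1 - u i - 2 * w) = #A * (1 - 2 * w) - ∑ i ∈ A, u i := by
        simp only [sum_sub_distrib, sum_const, nsmul_eq_mul]
        ring
      rw [this]
      have h0 : (0 : ℝ) ≤ #A := Nat.cast_nonneg _
      nlinarith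
    have h4 : Real.exp (2 * w) * N ≤ S :=
      (mul_le_mul_of_nonneg_left h3 (Real.exp_pos _).le).trans (h1.trans h)
    have h5 : Real.exp (2 * w) = Real.exp w * Real.exp w := by rw [← Real.exp_add]; ring_nf
    have h6 : 2 < Real.exp w := by linarith [Real.add_one_le_exp w]
    have h7 : 0 < Real.exp w * N := by positivity
    rw [h5, hSw] at h4
    nlinarith

/-- For numbers `u i` with mean zero, the means of `exp (u i)` and `exp (-u i)` are bounded, up to
constants, by the mean absolute differences of these two families. -/
lemma sum_exp_add_sum_exp_neg_le (u : ι → ℝ) (hu : ∑ i, u i = 0) :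
    Fintype.card ι * (∑ i, Real.exp (u i) + ∑ i, Real.exp (-u i)) ≤
      16 * (∑ i, ∑ j, |Real.exp (u i) - Real.exp (u j)| +
        ∑ i, ∑ j, |Real.exp (-u i) - Real.exp (-u j)|) +
        4 * Real.exp 4 * (Fintype.card ι : ℝ) ^ 2 := by
  have hN0 : (0 : ℝ) ≤ Fintype.card ι := by positivity
  have hD : 0 ≤ ∑ i, ∑ j, |Real.exp (u i) - Real.exp (u j)| := by positivity
  have hD' : 0 ≤ ∑ i, ∑ j, |Real.exp (-u i) - Real.exp (-u j)| := by positivity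
  rcases le_total (∑ i, Real.exp (-u i)) (∑ i, Real.exp (u i)) with h | h
  · have h1 := sum_exp_le_of_sum_exp_neg_le u hu h
    have h2 := mul_le_mul_of_nonneg_left h hN0
    linarith
  · have h1 := sum_exp_le_of_sum_exp_neg_le (fun i => -u i) (by simp [hu]) (by simpa using h)
    have h2 := mul_le_mul_of_nonneg_left h hN0
    linarith

end MeanDifference

/-! ### The exponential potential -/

/-- The average load. -/
noncomputable def meanLoad (x : Fin n → ℕ) : ℝ := (∑ i, x i : ℕ) / n

/-- The one-sided exponential potential with parameter `a`: large loads dominate it if `a > 0`,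
small ones if `a < 0`. -/
noncomputable def expPotential (a : ℝ) (x : Fin n → ℕ) : ℝ :=
  ∑ i, Real.exp (a * (x i - meanLoad x))

lemma expPotential_nonneg (a : ℝ) (x : Fin n → ℕ) : 0 ≤ expPotential a x := by
  unfold expPotential
  positivity

lemma meanLoad_step [NeZero d] (x : Fin n → ℕ) (s : Fin d → Fin n) :
    meanLoad (step x s) = meanLoad x + 1 / n := by
  unfold meanLoad
  rw [sum_load_step]
  push_cast
  ring

lemma expPotential_step [NeZero d] (a : ℝ) (x : Fin n → ℕ) (s : Fin d → Fin n) :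
    expPotential a (step x s) = Real.exp (-(a / n)) * (expPotential a x +
      (Real.exp a - 1) * Real.exp (a * (x (greedyBin x s) - meanLoad x))) := by
  have h := sum_step x s fun k => Real.exp (-(a / n)) * Real.exp (a * (k - meanLoad x))
  have h1 : expPotential a (step x s) =
      ∑ i, Real.exp (-(a / n)) * Real.exp (a * (step x s i - meanLoad x)) := by
    unfold expPotential
    refine sum_congr rfl fun i _ => ?_
    rw [meanLoad_step, ← Real.exp_add]
    ring_nf
  have h2 : Real.exp (a * (((x (greedyBin x s) + 1 : ℕ) : ℝ) - meanLoad x)) =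
      Real.exp a * Real.exp (a * (x (greedyBin x s) - meanLoad x)) := by
    rw [← Real.exp_add]
    push_cast
    ring_nf
  rw [h1, h, h2, ← mul_sum]
  unfold expPotential
  ring

/-- The function `t ↦ (exp a - 1) * exp (a * t)` is monotone whatever the sign of `a`. -/
lemma exp_sub_one_mul_exp_mono (a : ℝ) {t t' : ℝ} (h : t ≤ t') :
    (Real.exp a - 1) * Real.exp (a * t) ≤ (Real.exp a - 1) * Real.exp (a * t') := by
  rcases le_total 0 a with ha | ha
  · have : 0 ≤ Real.exp a - 1 := by linarith [Real.add_one_le_exp a]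
    gcongr
  · have : Real.exp a - 1 ≤ 0 := by linarith [Real.exp_le_one_iff.mpr ha]
    refine mul_le_mul_of_nonpos_left (Real.exp_le_exp.mpr ?_) this
    exact mul_le_mul_of_nonpos_left h ha

/-- Expected change of the potential in one step. The ball goes to a bin at most as loaded as the
first two samples, and `min p q = (p + q) / 2 - |p - q| / 2`. -/
lemma markov_expPotential_le [NeZero n] [NeZero d] (hd : 2 ≤ d) (a : ℝ) (x : Fin n → ℕ) :
    markov n d (expPotential a) x ≤ Real.exp (-(a / n)) * (expPotential a x +
      ((Real.exp a - 1) * (expPotential a x / n) - |Real.exp a - 1| / (2 * n ^ 2) *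
        ∑ i, ∑ j, |Real.exp (a * (x i - meanLoad x)) - Real.exp (a * (x j - meanLoad x))|)) := by
  have hn : (n : ℝ) ≠ 0 := by exact_mod_cast NeZero.ne n
  set c := Real.exp a - 1
  set V : Fin n → ℝ := fun i => Real.exp (a * (x i - meanLoad x)) with hV
  have key : 𝔼 s : Fin d → Fin n, c * V (greedyBin x s) ≤
      c * (expPotential a x / n) - |c| / (2 * n ^ 2) * ∑ i, ∑ j, |V i - V j| := by
    calc 𝔼 s : Fin d → Fin n, c * V (greedyBin x s)
        ≤ 𝔼 s : Fin d → Fin n, (fun i j => c * (V i + V j) / 2 - |c| * |V i - V j| / 2)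
            (s ⟨0, by omega⟩) (s ⟨1, by omega⟩) := by
          refine expect_le_expect fun s _ => ?_
          have h0 : c * V (greedyBin x s) ≤ c * V (s ⟨0, by omega⟩) :=
            exp_sub_one_mul_exp_mono a (by
              have := load_greedyBin_le x s ⟨0, by omega⟩
              have : (x (greedyBin x s) : ℝ) ≤ x (s ⟨0, by omega⟩) := by exact_mod_cast this
              linarith)
          have h1 : c * V (greedyBin x s) ≤ c * V (s ⟨1, by omega⟩) :=
            exp_sub_one_mul_exp_mono a (by
              have := load_greedyBin_le x s ⟨1, by omega⟩
              have : (x (greedyBin x s) : ℝ) ≤ x (s ⟨1, by omega⟩) := by exact_mod_cast this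
              linarith)
          simp only
          rw [← abs_mul, mul_sub]
          rcases abs_cases (c * V (s ⟨0, by omega⟩) - c * V (s ⟨1, by omega⟩)) with h | h <;>
            rw [h.1] <;> linarith
      _ = 𝔼 i, 𝔼 j, (c * (V i + V j) / 2 - |c| * |V i - V j| / 2) :=
          expect_first_two hd fun i j => c * (V i + V j) / 2 - |c| * |V i - V j| / 2
      _ = c * (expPotential a x / n) - |c| / (2 * n ^ 2) * ∑ i, ∑ j, |V i - V j| := by
          simp only [Fintype.expect_eq_sum_div_card, Fintype.card_fin, sum_sub_distrib,
            ← sum_div, ← mul_sum, sum_add_distrib, sum_const, card_univ, nsmul_eq_mul]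
          change _ = c * ((∑ i, V i) / n) - _
          field_simp
          ring
  calc markov n d (expPotential a) x
      = Real.exp (-(a / n)) * (expPotential a x + 𝔼 s : Fin d → Fin n, c * V (greedyBin x s)) := by
        rw [markov_apply]
        simp only [expPotential_step]
        rw [← mul_expect, expect_add_distrib, Fintype.expect_const]
    _ ≤ _ := by gcongr

/-- `markov_expPotential_le` with the exponentials expanded to second order. -/
lemma markov_expPotential_le_of_abs_le [NeZero n] [NeZero d] (hd : 2 ≤ d) {a : ℝ}
    (ha : |a| ≤ 1 / 2) (x : Fin n → ℕ) :
    markov n d (expPotential a) x ≤ expPotential a x + 2 * a ^ 2 / n * expPotential a x -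
      |a| / (8 * n ^ 2) *
        ∑ i, ∑ j, |Real.exp (a * (x i - meanLoad x)) - Real.exp (a * (x j - meanLoad x))| := by
  have hn : (1 : ℝ) ≤ n := by exact_mod_cast NeZero.one_le
  have hn0 : (0 : ℝ) < n := by linarith
  set D := ∑ i, ∑ j, |Real.exp (a * (x i - meanLoad x)) - Real.exp (a * (x j - meanLoad x))|
  have hD : 0 ≤ D := by positivity
  have hP := expPotential_nonneg a x
  obtain ⟨ha1, ha2⟩ := abs_le.mp ha
  have hsq : |Real.exp a - 1 - a| ≤ a ^ 2 := Real.abs_exp_sub_one_sub_id_le (by linarith)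
  obtain ⟨hq1, hq2⟩ := abs_le.mp hsq
  have habs : |a| / 2 ≤ |Real.exp a - 1| := by
    have h1 : |a| ≤ |Real.exp a - 1| + |Real.exp a - 1 - a| := by
      have := abs_sub (Real.exp a - 1) (Real.exp a - 1 - a)
      simpa using this
    have h2 : a ^ 2 ≤ |a| / 2 := by
      rw [← sq_abs]
      nlinarith [abs_nonneg a]
    linarith
  have hdiv : |a / n| ≤ 1 / 2 := by
    rw [abs_div, abs_of_pos hn0, div_le_iff₀ hn0]
    linarith
  have hexp : 1 / 2 ≤ Real.exp (-(a / n)) := by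
    have := Real.add_one_le_exp (-(a / n))
    have := (abs_le.mp hdiv).2
    linarith
  have hgrow : Real.exp (-(a / n)) * (1 + (Real.exp a - 1) / n) ≤ 1 + 2 * a ^ 2 / n := by
    have h1 : 1 + (Real.exp a - 1) / n ≤ Real.exp ((a + a ^ 2) / n) := by
      have := Real.add_one_le_exp ((a + a ^ 2) / n)
      have h2 : (Real.exp a - 1) / n ≤ (a + a ^ 2) / n := by gcongr; linarith
      linarith
    have h3 : Real.exp (a ^ 2 / n) ≤ 1 + 2 * (a ^ 2 / n) := by
      have h4 : 0 ≤ a ^ 2 / n := by positivity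
      have h5 : a ^ 2 / n ≤ 1 := by
        rw [div_le_one hn0]
        nlinarith
      have h6 := (abs_le.mp (Real.abs_exp_sub_one_sub_id_le (x := a ^ 2 / n)
        (by rw [abs_of_nonneg h4]; exact h5))).2
      nlinarith
    calc Real.exp (-(a / n)) * (1 + (Real.exp a - 1) / n)
        ≤ Real.exp (-(a / n)) * Real.exp ((a + a ^ 2) / n) := by gcongr
      _ = Real.exp (a ^ 2 / n) := by rw [← Real.exp_add]; ring_nf
      _ ≤ 1 + 2 * (a ^ 2 / n) := h3
      _ = _ := by ring
  have hloss : |a| / (8 * n ^ 2) ≤ Real.exp (-(a / n)) * (|Real.exp a - 1| / (2 * n ^ 2)) := by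
    calc |a| / (8 * n ^ 2) = 1 / 2 * ((|a| / 2) / (2 * n ^ 2)) := by ring
      _ ≤ _ := by gcongr
  have h1 := mul_le_mul_of_nonneg_right hgrow hP
  have h2 := mul_le_mul_of_nonneg_right hloss hD
  refine (markov_expPotential_le hd a x).trans ?_
  calc _ = Real.exp (-(a / n)) * (1 + (Real.exp a - 1) / n) * expPotential a x -
        Real.exp (-(a / n)) * (|Real.exp a - 1| / (2 * n ^ 2)) * D := by ring
    _ ≤ (1 + 2 * a ^ 2 / n) * expPotential a x - |a| / (8 * n ^ 2) * D := by linarith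
    _ = _ := by ring

/-- The rate used in the exponential potential. -/
noncomputable def rate : ℝ := 1 / 512

lemma rate_pos : 0 < rate := by norm_num [rate]

/-- The two-sided exponential potential. -/
noncomputable def potential (x : Fin n → ℕ) : ℝ := expPotential rate x + expPotential (-rate) x

lemma markov_potential_le [NeZero n] [NeZero d] (hd : 2 ≤ d) (x : Fin n → ℕ) :
    markov n d potential x ≤ (1 - rate / (256 * n)) * potential x + rate / 32 * Real.exp 4 := by
  have hn : (1 : ℝ) ≤ n := by exact_mod_cast NeZero.one_le
  have hn0 : (0 : ℝ) < n := by linarith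
  have hr : |rate| ≤ 1 / 2 := by norm_num [rate]
  have h1 := markov_expPotential_le_of_abs_le hd hr x
  have h2 := markov_expPotential_le_of_abs_le (a := -rate) hd (by rwa [abs_neg]) x
  have hu : ∑ i, rate * ((x i : ℝ) - meanLoad x) = 0 := by
    rw [← mul_sum, sum_sub_distrib]
    simp only [meanLoad, sum_const, card_univ, Fintype.card_fin, nsmul_eq_mul, Nat.cast_sum]
    field_simp
    simp
  have h3 := sum_exp_add_sum_exp_neg_le _ hu
  simp only [← neg_mul, Fintype.card_fin] at h3
  change (n : ℝ) * (expPotential rate x + expPotential (-rate) x) ≤ _ at h3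
  change _ ≤ (1 - rate / (256 * n)) * (expPotential rate x + expPotential (-rate) x) + _
  have h4 : markov n d potential x =
      markov n d (expPotential rate) x + markov n d (expPotential (-rate)) x := by
    have : (potential : (Fin n → ℕ) → ℝ) = expPotential rate + expPotential (-rate) := rfl
    rw [this, map_add, Pi.add_apply]
  rw [h4]
  rw [abs_of_pos rate_pos] at h1
  rw [abs_neg, abs_of_pos rate_pos, neg_sq] at h2
  set D := ∑ i, ∑ j, |Real.exp (rate * (x i - meanLoad x)) - Real.exp (rate * (x j - meanLoad x))|
  set D' := ∑ i, ∑ j,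
    |Real.exp (-rate * (x i - meanLoad x)) - Real.exp (-rate * (x j - meanLoad x))|
  set P := expPotential rate x
  set P' := expPotential (-rate) x
  have h5 : rate / (128 * n ^ 2) * (n * (P + P')) ≤
      rate / (128 * n ^ 2) * (16 * (D + D') + 4 * Real.exp 4 * (n : ℝ) ^ 2) := by
    have := rate_pos
    gcongr
  have h6 : rate / (128 * n ^ 2) * (n * (P + P')) = rate / 128 / n * (P + P') := by
    field_simp
  have h7 : rate / (128 * n ^ 2) * (16 * (D + D') + 4 * Real.exp 4 * (n : ℝ) ^ 2) =
      rate / (8 * n ^ 2) * (D + D') + rate / 32 * Real.exp 4 := by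
    field_simp
    ring
  have h8 : 2 * rate ^ 2 / n * (P + P') = rate / 256 / n * (P + P') := by
    have : 2 * rate ^ 2 = rate / 256 := by norm_num [rate]
    rw [this]
  have h9 : (1 - rate / (256 * n)) * (P + P') =
      P + P' + rate / 256 / n * (P + P') - rate / 128 / n * (P + P') := by
    field_simp
    ring
  rw [h6, h7] at h5
  rw [h9]
  linarith

/-- The expected potential is linear in the number of bins, at all times. -/
lemma markov_pow_potential_le [NeZero n] [NeZero d] (hd : 2 ≤ d) (m : ℕ) :
    (markov n d ^ m) potential 0 ≤ 8 * Real.exp 4 * n := by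
  have hn : (1 : ℝ) ≤ n := by exact_mod_cast NeZero.one_le
  have hn0 : (0 : ℝ) < n := by linarith
  induction m with
  | zero =>
    have : potential (0 : Fin n → ℕ) = 2 * n := by
      simp [potential, expPotential, meanLoad]
      ring
    rw [pow_zero, Module.End.one_apply, this]
    have := Real.add_one_le_exp 4
    nlinarith
  | succ m ih =>
    have h1 := markov_pow_mono m (d := d) (show markov n d potential ≤
      (1 - rate / (256 * n)) • potential + (fun _ => rate / 32 * Real.exp 4) from
        markov_potential_le hd) 0
    rw [map_add, map_smul, markov_pow_const] at h1
    simp only [Pi.add_apply, Pi.smul_apply, smul_eq_mul] at h1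
    rw [markov_pow_succ]
    have h2 : 0 ≤ 1 - rate / (256 * n) := by
      rw [sub_nonneg, div_le_one (by positivity)]
      have : rate ≤ 1 := by norm_num [rate]
      linarith
    have h3 := mul_le_mul_of_nonneg_left ih h2
    refine h1.trans ((add_le_add_left h3 _).trans (le_of_eq ?_))
    field_simp
    ring

/-! ### Layered induction -/

/-- The number of bins with load at least `h`. -/
def levelCount (h : ℕ) (x : Fin n → ℕ) : ℕ := #{i | h ≤ x i}

lemma levelCount_mono (h : ℕ) {x y : Fin n → ℕ} (hxy : x ≤ y) :
    levelCount h x ≤ levelCount h y :=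
  card_le_card (monotone_filter_right univ fun i _ hi => le_trans hi (hxy i))

lemma levelCount_eq_zero {h : ℕ} {x : Fin n → ℕ} (hx : ∀ i, x i < h) : levelCount h x = 0 := by
  simp [levelCount, filter_eq_empty_iff, hx]

lemma levelCount_eq_sum (h : ℕ) (x : Fin n → ℕ) :
    (levelCount h x : ℝ) = ∑ i, if h ≤ x i then (1 : ℝ) else 0 := by
  simp [levelCount]

/-- The number of bins with load above `h`, counted only as long as at most `B` bins have load at
least `h`. -/
noncomputable def cappedCount (h : ℕ) (B : ℝ) (x : Fin n → ℕ) : ℝ :=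
  if (levelCount h x : ℝ) ≤ B then (levelCount (h + 1) x : ℝ) else 0

lemma cappedCount_nonneg (h : ℕ) (B : ℝ) (x : Fin n → ℕ) : 0 ≤ cappedCount h B x := by
  unfold cappedCount
  split_ifs <;> positivity

/-- A ball raises a bin above the level `h` only if all its samples have load at least `h`. -/
lemma levelCount_succ_step_le [NeZero d] (h : ℕ) (x : Fin n → ℕ) (s : Fin d → Fin n) :
    (levelCount (h + 1) (step x s) : ℝ) ≤
      levelCount (h + 1) x + ∏ j, if h ≤ x (s j) then (1 : ℝ) else 0 := by
  rw [levelCount_eq_sum, levelCount_eq_sum,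
    sum_step x s fun k => if h + 1 ≤ k then (1 : ℝ) else 0]
  have h0 : (0 : ℝ) ≤ ∏ j, if h ≤ x (s j) then (1 : ℝ) else 0 :=
    prod_nonneg fun j _ => by split_ifs <;> norm_num
  gcongr
  by_cases hb : h ≤ x (greedyBin x s)
  · have h1 : ∏ j, (if h ≤ x (s j) then (1 : ℝ) else 0) = 1 :=
      prod_eq_one fun j _ => if_pos (hb.trans (load_greedyBin_le x s j))
    rw [h1]
    split_ifs <;> norm_num
  · rw [if_neg (by omega), if_neg (by omega)]
    simpa using h0

lemma markov_cappedCount_le [NeZero n] [NeZero d] (h : ℕ) {B : ℝ} (hB : 0 ≤ B)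
    (x : Fin n → ℕ) :
    markov n d (cappedCount h B) x ≤ cappedCount h B x + (B / n) ^ d := by
  have hBn : 0 ≤ (B / n) ^ d := by positivity
  rw [markov_apply]
  by_cases hx : (levelCount h x : ℝ) ≤ B
  · calc 𝔼 s : Fin d → Fin n, cappedCount h B (step x s)
        ≤ 𝔼 s : Fin d → Fin n, ((levelCount (h + 1) x : ℝ) +
            ∏ j, if h ≤ x (s j) then (1 : ℝ) else 0) := by
          refine expect_le_expect fun s _ => le_trans ?_ (levelCount_succ_step_le h x s)
          unfold cappedCount
          split_ifs
          · exact le_rfl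
          · positivity
      _ = levelCount (h + 1) x + (levelCount h x / n) ^ d := by
          rw [expect_add_distrib, Fintype.expect_const, levelCount_eq_sum h x]
          have := (expect_pow univ (fun i => if h ≤ x i then (1 : ℝ) else 0) d).symm
          rw [Fintype.piFinset_univ] at this
          rw [this, Fintype.expect_eq_sum_div_card, Fintype.card_fin]
      _ ≤ cappedCount h B x + (B / n) ^ d := by
          rw [cappedCount, if_pos hx]
          gcongr
  · calc 𝔼 s : Fin d → Fin n, cappedCount h B (step x s)
        = 𝔼 s : Fin d → Fin n, (0 : ℝ) := by
          refine expect_congr rfl fun s _ => if_neg fun hs => hx (le_trans ?_ hs)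
          exact_mod_cast levelCount_mono h (le_step x s)
      _ ≤ _ := by
          rw [Fintype.expect_const]
          exact add_nonneg (cappedCount_nonneg h B x) hBn

/-- If the level `h + k` is too full, then there is a first level that is too full. -/
lemma one_le_of_lt_levelCount (h : ℕ) {B : ℕ → ℝ} (hB : ∀ i, 0 < B i) (x : Fin n → ℕ) (k : ℕ)
    (hk : B k < levelCount (h + k) x) :
    1 ≤ levelCount h x / B 0 + ∑ i ∈ range k, cappedCount (h + i) (B i) x / B (i + 1) := by
  induction k with
  | zero =>
    rw [range_zero, sum_empty, add_zero, one_le_div (hB 0)]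
    exact hk.le
  | succ k ih =>
    rw [sum_range_succ]
    by_cases hc : (levelCount (h + k) x : ℝ) ≤ B k
    · have h1 : 1 ≤ cappedCount (h + k) (B k) x / B (k + 1) := by
        rw [cappedCount, if_pos hc, one_le_div (hB _)]
        exact hk.le
      have h2 : 0 ≤ (levelCount h x : ℝ) / B 0 := div_nonneg (by positivity) (hB 0).le
      have h3 : 0 ≤ ∑ i ∈ range k, cappedCount (h + i) (B i) x / B (i + 1) :=
        sum_nonneg fun i _ => div_nonneg (cappedCount_nonneg _ _ _) (hB _).le
      linarith
    · have h1 := ih (not_le.mp hc)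
      have h2 : 0 ≤ cappedCount (h + k) (B k) x / B (k + 1) :=
        div_nonneg (cappedCount_nonneg _ _ _) (hB _).le
      linarith

/-- If all loads are at most `h`, then `T` steps later some load is `h + k` or more only with small
probability: the `i`-th summand bounds the probability that the level `h + i + 1` is the first one
too full. -/
lemma markov_pow_sup_ge_le [NeZero n] [NeZero d] (h k T : ℕ) {B : ℕ → ℝ} (hB : ∀ i, 0 < B i)
    (hk : B k < 1) (x : Fin n → ℕ) (hx : ∀ i, x i ≤ h) :
    (markov n d ^ T) (fun y => if h + k ≤ univ.sup y then 1 else 0) x ≤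
      (markov n d ^ T) (fun y => (levelCount h y : ℝ)) x / B 0 +
        ∑ i ∈ range k, T * (B i / n) ^ d / B (i + 1) := by
  have h1 : (fun y : Fin n → ℕ => if h + k ≤ univ.sup y then (1 : ℝ) else 0) ≤
      (B 0)⁻¹ • (fun y : Fin n → ℕ => (levelCount h y : ℝ)) +
        ∑ i ∈ range k, (B (i + 1))⁻¹ • cappedCount (h + i) (B i) := by
    intro y
    simp only [Pi.add_apply, Pi.smul_apply, smul_eq_mul, Finset.sum_apply, ← div_eq_inv_mul]
    split_ifs with hy
    · refine one_le_of_lt_levelCount h hB y k (hk.trans_le ?_)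
      obtain ⟨i, -, hi⟩ := exists_mem_eq_sup (univ : Finset (Fin n)) univ_nonempty y
      rw [hi] at hy
      have : 0 < levelCount (h + k) y := card_pos.mpr ⟨i, by simpa using hy⟩
      exact_mod_cast this
    · exact add_nonneg (div_nonneg (by positivity) (hB 0).le)
        (sum_nonneg fun i _ => div_nonneg (cappedCount_nonneg _ _ _) (hB _).le)
  refine (markov_pow_mono T h1 x).trans ?_
  simp only [map_add, map_sum, map_smul, Pi.add_apply, Pi.smul_apply, smul_eq_mul, Finset.sum_apply,
    ← div_eq_inv_mul]
  gcongr with i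
  · exact (hB _).le
  · have h2 := markov_pow_le_add T (markov_cappedCount_le (d := d) (h + i) (hB i).le) x
    have h3 : cappedCount (h + i) (B i) x = 0 := by
      rw [cappedCount, levelCount_eq_zero (h := h + i + 1) fun j => Nat.lt_succ_of_le
        ((hx j).trans (Nat.le_add_right h i))]
      simp
    linarith

/-- The caps used in the layered induction, as fractions of the number of bins. They satisfy
`L * β i ^ d / β (i + 1) ≤ δ / 2 ^ i`, so that the failure probabilities are summable although only
Markov's inequality is used; the factor `2 ^ d ^ i` makes them decrease doubly exponentially. -/
noncomputable def levelCap (d : ℕ) (ρ : ℝ) (i : ℕ) : ℝ := ρ * (1 / 2) ^ (i + 1) * (1 / 2) ^ d ^ i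

lemma levelCap_pos (d : ℕ) {ρ : ℝ} (hρ : 0 < ρ) (i : ℕ) : 0 < levelCap d ρ i := by
  unfold levelCap
  positivity

lemma levelCap_pow_le (hd : 2 ≤ d) {ρ : ℝ} (hρ : 0 < ρ) (hρ1 : ρ ≤ 1) (i : ℕ) :
    levelCap d ρ i ^ d ≤ ρ * (1 / 2) ^ i * levelCap d ρ (i + 1) := by
  have h1 : ρ ^ d ≤ ρ * ρ := by
    rw [← pow_two]
    exact pow_le_pow_of_le_one hρ.le hρ1 hd
  have h2 : ((1 / 2 : ℝ) ^ (i + 1)) ^ d ≤ (1 / 2) ^ i * (1 / 2) ^ (i + 1 + 1) := by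
    rw [← pow_mul, ← pow_add]
    refine pow_le_pow_of_le_one (by norm_num) (by norm_num) ?_
    nlinarith
  unfold levelCap
  rw [mul_pow, mul_pow, ← pow_mul (1 / 2 : ℝ) (d ^ i) d, ← pow_succ]
  calc ρ ^ d * ((1 / 2) ^ (i + 1)) ^ d * (1 / 2) ^ d ^ (i + 1)
      ≤ (ρ * ρ) * ((1 / 2) ^ i * (1 / 2) ^ (i + 1 + 1)) * (1 / 2) ^ d ^ (i + 1) := by gcongr
    _ = _ := by ring

/-- Layered induction: from loads at most `h`, within `T ≤ L * n` steps, the maximum load reaches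
`h + k` with probability at most `2 * δ` plus a multiple of the expected number of bins with load
at least `h` at the end, provided that `n ≤ 2 ^ d ^ k`. -/
lemma markov_pow_sup_ge_le_of_pow [NeZero n] [NeZero d] (hd : 2 ≤ d) {h k T L : ℕ} (hL : 1 ≤ L)
    (hT : T ≤ L * n) (hk : n ≤ 2 ^ d ^ k) {δ : ℝ} (hδ : 0 < δ) (hδ1 : δ ≤ 1) (x : Fin n → ℕ)
    (hx : ∀ i, x i ≤ h) :
    (markov n d ^ T) (fun y => if h + k ≤ univ.sup y then 1 else 0) x ≤
      (markov n d ^ T) (fun y => (levelCount h y : ℝ)) x * (4 * L / (δ * n)) + 2 * δ := by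
  have hn : (1 : ℝ) ≤ n := by exact_mod_cast NeZero.one_le
  have hn0 : (0 : ℝ) < n := by linarith
  have hL1 : (1 : ℝ) ≤ L := by exact_mod_cast hL
  have hL0 : (0 : ℝ) < L := by linarith
  set ρ := δ / L with hρdef
  have hρ : 0 < ρ := by positivity
  have hρ1 : ρ ≤ 1 := by
    rw [div_le_one hL0]
    linarith
  have hB : ∀ i, 0 < n * levelCap d ρ i := fun i => mul_pos hn0 (levelCap_pos d hρ i)
  have hBk : n * levelCap d ρ k < 1 := by
    have h1 : (n : ℝ) * (1 / 2) ^ d ^ k ≤ 1 := by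
      rw [one_div, inv_pow, ← div_eq_mul_inv, div_le_one (by positivity)]
      exact_mod_cast hk
    have h2 : (1 / 2 : ℝ) ^ (k + 1) ≤ 1 / 2 := by
      rw [pow_succ]
      have : (1 / 2 : ℝ) ^ k ≤ 1 := pow_le_one₀ (by norm_num) (by norm_num)
      linarith
    have h3 : ρ * (1 / 2 : ℝ) ^ (k + 1) ≤ 1 / 2 := by
      have : (0 : ℝ) ≤ (1 / 2) ^ (k + 1) := by positivity
      nlinarith
    calc n * levelCap d ρ k = ρ * (1 / 2) ^ (k + 1) * (n * (1 / 2) ^ d ^ k) := by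
          unfold levelCap
          ring
      _ ≤ 1 / 2 * 1 := by gcongr
      _ < 1 := by norm_num
  refine (markov_pow_sup_ge_le h k T (B := fun i => n * levelCap d ρ i) hB hBk x hx).trans ?_
  have h0 : n * levelCap d ρ 0 = δ * n / (4 * L) := by
    simp only [levelCap, hρdef]
    field_simp
    norm_num
  refine add_le_add (le_of_eq ?_) ?_
  · simp only [h0]
    field_simp
  · calc ∑ i ∈ range k, T * (n * levelCap d ρ i / n) ^ d / (n * levelCap d ρ (i + 1))
        ≤ ∑ i ∈ range k, δ * (1 / 2) ^ i := by
          refine sum_le_sum fun i _ => ?_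
          rw [mul_div_cancel_left₀ _ hn0.ne', div_le_iff₀ (hB _)]
          have hT' : (T : ℝ) ≤ L * n := by exact_mod_cast hT
          calc (T : ℝ) * levelCap d ρ i ^ d
              ≤ (L * n) * (ρ * (1 / 2) ^ i * levelCap d ρ (i + 1)) := by
                have := levelCap_pow_le hd hρ hρ1 i
                have := levelCap_pos d hρ i
                gcongr
            _ = δ * (1 / 2) ^ i * (n * levelCap d ρ (i + 1)) := by
                rw [hρdef]
                field_simp
      _ = δ * ∑ i ∈ range k, (1 / 2) ^ i := by rw [mul_sum]
      _ ≤ 2 * δ := by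
          have := sum_geometric_two_le k
          nlinarith

/-! ### Tails of the gap -/

lemma gapTail_nonneg [NeZero n] [NeZero d] (m : ℕ) (y : ℝ) : 0 ≤ gapTail n d m y := by
  have h := markov_pow_mono (d := d) m (show (fun _ : Fin n → ℕ => (0 : ℝ)) ≤
    fun x => if y < loadGap x then 1 else 0 from fun x => by
      dsimp only
      split_ifs <;> norm_num) 0
  rwa [markov_pow_const] at h

lemma gapTail_antitone [NeZero d] (m : ℕ) {y z : ℝ} (hyz : y ≤ z) :
    gapTail n d m z ≤ gapTail n d m y := by
  refine markov_pow_mono m (fun x => ?_) 0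
  dsimp only
  split_ifs with h1 h2
  · exact le_rfl
  · exact absurd (hyz.trans_lt h1) h2
  · norm_num
  · exact le_rfl

lemma expPotential_le_potential (x : Fin n → ℕ) : expPotential rate x ≤ potential x :=
  le_add_of_nonneg_right (expPotential_nonneg _ x)

lemma gapTail_le_exp [NeZero n] [NeZero d] (hd : 2 ≤ d) (m : ℕ) (y : ℝ) :
    gapTail n d m y ≤ Real.exp (-(rate * y)) * (8 * Real.exp 4 * n) := by
  have h1 : (fun x : Fin n → ℕ => if y < loadGap x then (1 : ℝ) else 0) ≤
      Real.exp (-(rate * y)) • potential := by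
    intro x
    simp only [Pi.smul_apply, smul_eq_mul]
    split_ifs with hy
    · obtain ⟨i, -, hi⟩ := exists_mem_eq_sup (univ : Finset (Fin n)) univ_nonempty x
      have h2 : Real.exp (rate * (x i - meanLoad x)) ≤ expPotential rate x :=
        single_le_sum (f := fun i => Real.exp (rate * (x i - meanLoad x)))
          (fun i _ => (Real.exp_pos _).le) (mem_univ i)
      have h3 : Real.exp (rate * y) ≤ Real.exp (rate * (x i - meanLoad x)) := by
        have := rate_pos
        rw [loadGap, hi] at hy
        change y < x i - meanLoad x at hy
        gcongr
      have h4 := (h3.trans h2).trans (expPotential_le_potential x)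
      calc (1 : ℝ) = Real.exp (-(rate * y)) * Real.exp (rate * y) := by
            rw [← Real.exp_add, neg_add_cancel, Real.exp_zero]
        _ ≤ _ := by gcongr
    · have := expPotential_nonneg rate x
      have := expPotential_le_potential x
      exact mul_nonneg (Real.exp_pos _).le (by linarith)
  refine (markov_pow_mono m h1 0).trans ?_
  rw [map_smul, Pi.smul_apply, smul_eq_mul]
  have := markov_pow_potential_le (n := n) hd m
  gcongr

/-- The expected number of bins whose load exceeds the average by `ℓ` or more. -/
lemma markov_pow_levelCount_le [NeZero n] [NeZero d] (hd : 2 ≤ d) (m h : ℕ) {l : ℝ}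
    (hl : (m : ℝ) / n + l ≤ h) :
    (markov n d ^ m) (fun y => (levelCount h y : ℝ)) 0 ≤
      Real.exp (-(rate * l)) * (8 * Real.exp 4 * n) := by
  have h1 : (markov n d ^ m) (fun y => (levelCount h y : ℝ)) 0 ≤
      (markov n d ^ m) (Real.exp (-(rate * l)) • potential) 0 := by
    refine markov_pow_mono_of_sum m 0 fun y hy => ?_
    have hy' : meanLoad y = m / n := by simp [meanLoad, hy]
    rw [Pi.smul_apply, smul_eq_mul, levelCount_eq_sum]
    refine le_trans ?_ (mul_le_mul_of_nonneg_left (expPotential_le_potential y)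
      (Real.exp_pos _).le)
    rw [expPotential, mul_sum]
    refine sum_le_sum fun i _ => ?_
    split_ifs with hi
    · rw [← Real.exp_add, Real.one_le_exp_iff]
      have h2 : (h : ℝ) ≤ y i := by exact_mod_cast hi
      have h3 : 0 ≤ rate * (y i - meanLoad y - l) := by
        have := rate_pos
        refine mul_nonneg this.le ?_
        rw [hy']
        linarith
      linarith
    · positivity
  refine h1.trans ?_
  rw [map_smul, Pi.smul_apply, smul_eq_mul]
  have := markov_pow_potential_le (n := n) hd m
  gcongr

lemma le_two_pow_pow_ceil (hd : 2 ≤ d) (hn : 2 ≤ n) :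
    n ≤ 2 ^ d ^ ⌈Real.logb d (Real.logb 2 n)⌉₊ := by
  have hd1 : (1 : ℝ) < d := by exact_mod_cast hd
  have hn0 : (0 : ℝ) < n := by positivity
  have hlog : 0 < Real.logb 2 n := Real.logb_pos (by norm_num) (by exact_mod_cast hn)
  have h1 := Nat.le_ceil (Real.logb d (Real.logb 2 n))
  rw [Real.logb_le_iff_le_rpow hd1 hlog, Real.rpow_natCast,
    Real.logb_le_iff_le_rpow (by norm_num) hn0] at h1
  have h2 : (n : ℝ) ≤ 2 ^ (d ^ ⌈Real.logb d (Real.logb 2 n)⌉₊) := by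
    rw [← Real.rpow_natCast]
    push_cast
    exact h1
  exact_mod_cast h2

/-- Gap reduction: if the gap exceeds `L` with probability at most `q` at all times, then, up to an
additional failure probability, it exceeds `log_d log₂ n` at most by a multiple of `log L`. The
process is restarted `L * n` balls earlier: then a gap of at most `L` means that no load exceeds
the final average, so that all balls above the final average are among the last `L * n`. -/
lemma gapTail_le_add [NeZero n] [NeZero d] (hd : 2 ≤ d) (hn : 2 ≤ n) {L : ℕ} (hL : 1 ≤ L) {q : ℝ}
    (hq : ∀ m, gapTail n d m L ≤ q) {t : ℝ} (ht : 0 ≤ t) (m : ℕ) :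
    gapTail n d m (Real.logb d (Real.logb 2 n) +
      (Real.log (32 * Real.exp 4 * L) + 2 * t) / rate + 2) ≤ q + 3 * Real.exp (-t) := by
  have hn0 : (0 : ℝ) < n := by positivity
  have hL1 : (1 : ℝ) ≤ L := by exact_mod_cast hL
  have hr := rate_pos
  set l := (Real.log (32 * Real.exp 4 * L) + 2 * t) / rate with hl
  set k := ⌈Real.logb d (Real.logb 2 n)⌉₊ with hk
  set h := ⌈(m : ℝ) / n + l⌉₊ with hh
  have hKL : 1 ≤ 32 * Real.exp 4 * L := by nlinarith [Real.add_one_le_exp 4]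
  have hl0 : 0 ≤ l := by
    have := Real.log_nonneg hKL
    positivity
  have hhl : (m : ℝ) / n + l ≤ h := Nat.le_ceil _
  have hll : 0 ≤ Real.logb d (Real.logb 2 n) := by
    refine Real.logb_nonneg (by exact_mod_cast hd) ?_
    rw [Real.le_logb_iff_rpow_le (by norm_num) hn0, Real.rpow_one]
    exact_mod_cast hn
  -- with fewer than `L * n` balls the process is followed from the empty allocation instead
  obtain ⟨m₀, T, hmT, hT, hstart⟩ : ∃ m₀ T, m = m₀ + T ∧ T ≤ L * n ∧
      (markov n d ^ m₀) (fun x => if h < univ.sup x then 1 else 0) 0 ≤ q := by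
    rcases le_total m (L * n) with hm | hm
    · refine ⟨0, m, (zero_add m).symm, hm, ?_⟩
      have : univ.sup (0 : Fin n → ℕ) = 0 := by simp
      rw [pow_zero, Module.End.one_apply, this, if_neg (by omega)]
      exact (gapTail_nonneg 0 _).trans (hq 0)
    · refine ⟨m - L * n, L * n, by omega, le_rfl, le_trans ?_ (hq (m - L * n))⟩
      refine markov_pow_mono_of_sum _ 0 fun y hy => ?_
      by_cases hy1 : h < univ.sup y
      · have hy2 : (h : ℝ) < (univ.sup y : ℕ) := by exact_mod_cast hy1
        have hy3 : (L : ℝ) < loadGap y := by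
          have : ((m - L * n : ℕ) : ℝ) / n = m / n - L := by
            rw [Nat.cast_sub hm]
            push_cast
            field_simp
          rw [loadGap, hy]
          simp only [Pi.zero_apply, sum_const_zero, zero_add]
          rw [this]
          linarith
        rw [if_pos hy1, if_pos hy3]
      · rw [if_neg hy1]
        split_ifs <;> norm_num
  have hlow : gapTail n d m (Real.logb d (Real.logb 2 n) + l + 2) ≤
      (markov n d ^ m) (fun y => if h + k ≤ univ.sup y then 1 else 0) 0 := by
    refine markov_pow_mono_of_sum m 0 fun y hy => ?_
    by_cases hy1 : Real.logb d (Real.logb 2 n) + l + 2 < loadGap y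
    · have hy2 : h + k ≤ univ.sup y := by
        have h1 : (h : ℝ) < m / n + l + 1 := Nat.ceil_lt_add_one (by positivity)
        have h2 : (k : ℝ) < Real.logb d (Real.logb 2 n) + 1 := Nat.ceil_lt_add_one hll
        rw [loadGap, hy] at hy1
        simp only [Pi.zero_apply, sum_const_zero, zero_add] at hy1
        have h3 : ((h + k : ℕ) : ℝ) < (univ.sup y : ℕ) := by
          push_cast
          linarith
        exact_mod_cast h3.le
      rw [if_pos hy1, if_pos hy2]
    · rw [if_neg hy1]
      split_ifs <;> norm_num
  set δ := Real.exp (-t) with hδ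
  have hδ0 : 0 < δ := Real.exp_pos _
  have hδ1 : δ ≤ 1 := Real.exp_le_one_iff.mpr (by linarith)
  set c : ℝ := 4 * L / (δ * n) with hc
  have hc0 : 0 ≤ c := by positivity
  have hstep : (markov n d ^ T) (fun y => if h + k ≤ univ.sup y then 1 else 0) ≤
      (fun x => if h < univ.sup x then 1 else 0) +
        (c • (markov n d ^ T) (fun y => (levelCount h y : ℝ)) + fun _ => 2 * δ) := by
    intro x
    have hν : 0 ≤ (markov n d ^ T) (fun y => (levelCount h y : ℝ)) x := by
      have := markov_pow_mono (d := d) T (show (fun _ : Fin n → ℕ => (0 : ℝ)) ≤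
        fun y => (levelCount h y : ℝ) from fun y => Nat.cast_nonneg _) x
      rwa [markov_pow_const] at this
    simp only [Pi.add_apply, Pi.smul_apply, smul_eq_mul]
    split_ifs with hx
    · have h1 := markov_pow_mono (d := d) T (show
        (fun y : Fin n → ℕ => if h + k ≤ univ.sup y then (1 : ℝ) else 0) ≤ fun _ => 1 from
          fun y => by
            dsimp only
            split_ifs <;> norm_num) x
      rw [markov_pow_const] at h1
      have : 0 ≤ c * (markov n d ^ T) (fun y => (levelCount h y : ℝ)) x := by positivity
      linarith
    · have h1 := markov_pow_sup_ge_le_of_pow hd hL hT (le_two_pow_pow_ceil hd hn) hδ0 hδ1 x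
        (fun i => (le_sup (mem_univ i)).trans (not_lt.mp hx))
      linarith
  have hcount := markov_pow_levelCount_le (n := n) hd m h hhl
  have hexp : c * (Real.exp (-(rate * l)) * (8 * Real.exp 4 * n)) = δ := by
    have h1 : Real.exp (-(rate * l)) = δ * δ / (32 * Real.exp 4 * L) := by
      rw [hl, mul_div_cancel₀ _ hr.ne', neg_add, Real.exp_add, Real.exp_neg,
        Real.exp_log (by linarith), hδ, ← Real.exp_add]
      field_simp
      ring_nf
    rw [h1, hc]
    field_simp
    norm_num
  refine hlow.trans ?_
  have h2 := markov_pow_mono (d := d) m₀ hstep 0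
  rw [← Module.End.mul_apply, ← pow_add, ← hmT, map_add, map_add, map_smul, markov_pow_const,
    ← Module.End.mul_apply, ← pow_add, ← hmT] at h2
  simp only [Pi.add_apply, Pi.smul_apply, smul_eq_mul] at h2
  have h3 := mul_le_mul_of_nonneg_left hcount hc0
  rw [hexp] at h3
  linarith

/-- Gap reduction for exponential tails: a tail on the scale `Y` becomes a tail of constant scale
around `log_d log₂ n` plus a multiple of `log Y`. -/
lemma gapTail_le_exp_neg [NeZero n] [NeZero d] (hd : 2 ≤ d) (hn : 2 ≤ n) {Y c q : ℝ}
    (hY : 1 / 2 ≤ Y) (hc : 0 < c)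
    (h : ∀ m j : ℕ, gapTail n d m (c * Y * (1 + j)) ≤ q * Real.exp (-j)) (m j : ℕ) :
    gapTail n d m (Real.logb d (Real.logb 2 n) + 2 +
        (Real.log (32 * Real.exp 4 * (c + 2)) + Real.log Y) / rate + 3 / rate * j) ≤
      (q + 3) * Real.exp (-j) := by
  have hr := rate_pos
  have hY0 : 0 < Y := by linarith
  have hj0 : (0 : ℝ) ≤ j := Nat.cast_nonneg j
  set L := ⌈c * Y * (1 + j)⌉₊
  have hL : 1 ≤ L := Nat.one_le_ceil_iff.mpr (by positivity)
  have h1 := gapTail_le_add (L := L) (q := q * Real.exp (-j)) hd hn hL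
    (fun m => (gapTail_antitone m (Nat.le_ceil _)).trans (h m j)) hj0 m
  have hL2 : (L : ℝ) ≤ (c + 2) * Y * (1 + j) := by
    have h2 : (L : ℝ) < c * Y * (1 + j) + 1 := Nat.ceil_lt_add_one (by positivity)
    nlinarith
  have hlog : Real.log (32 * Real.exp 4 * L) ≤
      Real.log (32 * Real.exp 4 * (c + 2)) + Real.log Y + j := by
    have hL0 : (0 : ℝ) < L := by exact_mod_cast hL
    calc Real.log (32 * Real.exp 4 * L)
        ≤ Real.log (32 * Real.exp 4 * (c + 2) * Y * (1 + j)) := by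
          refine Real.log_le_log (by positivity) ?_
          calc 32 * Real.exp 4 * L ≤ 32 * Real.exp 4 * ((c + 2) * Y * (1 + j)) := by gcongr
            _ = _ := by ring
      _ = Real.log (32 * Real.exp 4 * (c + 2)) + Real.log Y + Real.log (1 + j) := by
          rw [Real.log_mul (by positivity) (by positivity),
            Real.log_mul (by positivity) (by positivity)]
      _ ≤ _ := by
          have := Real.log_le_sub_one_of_pos (show (0 : ℝ) < 1 + j by positivity)
          linarith
  refine (gapTail_antitone m ?_).trans (h1.trans (by linarith))
  have h3 : (Real.log (32 * Real.exp 4 * L) + 2 * j) / rate ≤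
      (Real.log (32 * Real.exp 4 * (c + 2)) + Real.log Y + 3 * j) / rate :=
    div_le_div_of_nonneg_right (by linarith) hr.le
  have h4 : (Real.log (32 * Real.exp 4 * (c + 2)) + Real.log Y + 3 * j) / rate =
      (Real.log (32 * Real.exp 4 * (c + 2)) + Real.log Y) / rate + 3 / rate * j := by ring
  linarith

/-- Summing an exponential tail. -/
lemma expectedGap_le_of_gapTail [NeZero n] [NeZero d] {m : ℕ} {θ w q : ℝ} (hw : 0 < w)
    (hq : 0 ≤ q) (h : ∀ j : ℕ, gapTail n d m (θ + w * j) ≤ q * Real.exp (-j)) :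
    expectedGap n d m ≤ θ + 2 * q * w := by
  obtain ⟨J, hJ⟩ := exists_nat_ge ((m - θ) / w)
  rw [div_le_iff₀ hw] at hJ
  have hpt (x : Fin n → ℕ) (k : ℕ) : min (loadGap x) (θ + w * k) ≤
      θ + ∑ j ∈ range k, w * if θ + w * j < loadGap x then 1 else 0 := by
    induction k with
    | zero => simp
    | succ k ih =>
      rw [sum_range_succ]
      push_cast
      split_ifs with hx
      · rw [min_eq_right hx.le] at ih
        have := min_le_right (loadGap x) (θ + w * (k + 1))
        linarith
      · rw [min_eq_left (not_lt.mp hx)] at ih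
        have := min_le_left (loadGap x) (θ + w * (k + 1))
        linarith
  have hle : (markov n d ^ m) loadGap 0 ≤ (markov n d ^ m) ((fun _ => θ) +
      ∑ j ∈ range J, w • fun x => if θ + w * j < loadGap x then (1 : ℝ) else 0) 0 := by
    refine markov_pow_mono_of_sum m 0 fun x hx => ?_
    have h1 : loadGap x ≤ θ + w * J := by
      have h2 : univ.sup x ≤ m := by
        have : ∑ i, x i = m := by simpa using hx
        rw [← this]
        exact Finset.sup_le fun i _ => single_le_sum (fun _ _ => Nat.zero_le _) (mem_univ i)
      have h3 : ((univ.sup x : ℕ) : ℝ) ≤ m := by exact_mod_cast h2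
      have h4 : (0 : ℝ) ≤ (∑ i, x i : ℕ) / n := by positivity
      unfold loadGap
      linarith
    have h5 := hpt x J
    rw [min_eq_left h1] at h5
    simpa using h5
  rw [expectedGap_eq]
  refine hle.trans ?_
  simp only [map_add, map_sum, map_smul, Pi.add_apply, Pi.smul_apply, smul_eq_mul,
    Finset.sum_apply, markov_pow_const]
  have hsum : ∑ j ∈ range J, w * gapTail n d m (θ + w * j) ≤
      ∑ j ∈ range J, w * (q * (1 / 2) ^ j) := by
    refine sum_le_sum fun j _ => ?_
    have h6 : Real.exp (-j) ≤ (1 / 2) ^ j := by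
      have h7 : Real.exp (-1) ≤ 1 / 2 := by
        rw [Real.exp_neg, one_div]
        exact inv_anti₀ (by norm_num) (by linarith [Real.add_one_le_exp 1])
      calc Real.exp (-j) = Real.exp (-1) ^ j := by rw [← Real.exp_nat_mul]; ring_nf
        _ ≤ _ := by gcongr
    have := h j
    gcongr
    exact this.trans (by gcongr)
  change θ + ∑ j ∈ range J, w * gapTail n d m (θ + w * j) ≤ _
  have h8 : ∑ j ∈ range J, w * (q * (1 / 2) ^ j) = w * q * ∑ j ∈ range J, (1 / 2) ^ j := by
    rw [mul_sum]
    exact sum_congr rfl fun j _ => by ring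
  have h9 := mul_le_mul_of_nonneg_left (sum_geometric_two_le J) (show 0 ≤ w * q by positivity)
  linarith

/-! ### Iterated logarithms and the two rounds of gap reduction -/

lemma three_halves_le_logb (hn : 3 ≤ n) : 3 / 2 ≤ Real.logb 2 n := by
  have h1 : Real.logb 2 (8 : ℝ) = 3 := by
    rw [show (8 : ℝ) = 2 ^ (3 : ℝ) by norm_num, Real.logb_rpow (by norm_num) (by norm_num)]
  have h2 : Real.logb 2 (8 : ℝ) ≤ Real.logb 2 ((n : ℝ) ^ 2) := by
    have : (3 : ℝ) ≤ n := by exact_mod_cast hn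
    exact Real.logb_le_logb_of_le (by norm_num) (by norm_num) (by nlinarith)
  rw [h1, Real.logb_pow] at h2
  push_cast at h2
  linarith

lemma half_le_logb {y : ℝ} (hy : 3 / 2 ≤ y) : 1 / 2 ≤ Real.logb 2 y := by
  have h2 : Real.logb 2 (2 : ℝ) ≤ Real.logb 2 (y ^ 2) :=
    Real.logb_le_logb_of_le (by norm_num) (by norm_num) (by nlinarith)
  rw [Real.logb_self_eq_one (by norm_num), Real.logb_pow] at h2
  push_cast at h2
  linarith

lemma log_le_logb_two {y : ℝ} (hy : 1 ≤ y) : Real.log y ≤ Real.logb 2 y := by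
  rw [Real.logb, le_div_iff₀ (Real.log_pos (by norm_num))]
  have h1 := Real.log_nonneg hy
  have h2 := Real.log_le_sub_one_of_pos (show (0 : ℝ) < 2 by norm_num)
  nlinarith

/-- The tail of the gap on the scale `log n`. -/
lemma gapTail_logb_le [NeZero n] [NeZero d] (hd : 2 ≤ d) (hn : 3 ≤ n) (m j : ℕ) :
    gapTail n d m (12 / rate * Real.logb 2 n * (1 + j)) ≤ 1 * Real.exp (-j) := by
  have hn0 : (0 : ℝ) < n := by positivity
  have hlg := three_halves_le_logb hn
  have hlog : Real.log n ≤ Real.logb 2 n :=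
    log_le_logb_two (by exact_mod_cast (by omega : 1 ≤ n))
  have hj0 : (0 : ℝ) ≤ j := Nat.cast_nonneg j
  have h8 := Real.log_le_sub_one_of_pos (show (0 : ℝ) < 8 by norm_num)
  refine (gapTail_le_exp hd m _).trans ?_
  have h1 : 8 * Real.exp 4 * n = Real.exp (Real.log 8 + 4 + Real.log n) := by
    rw [Real.exp_add, Real.exp_add, Real.exp_log (by norm_num), Real.exp_log hn0]
  have h2 : rate * (12 / rate * Real.logb 2 n * (1 + j)) = 12 * Real.logb 2 n * (1 + j) := by
    have := rate_pos.ne'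
    field_simp
  rw [h1, h2, ← Real.exp_add, one_mul, Real.exp_le_exp]
  nlinarith

end BalancedAllocations

open BalancedAllocations in
theorem mainTheorem1 (d : ℕ) [NeZero d] (hd : 2 ≤ d) :
    ∃ α γ : ℝ, ∀ n : ℕ, 3 ≤ n → ∀ m : ℕ,
      BalancedAllocations.expectedGap n d m ≤
        Real.logb d (Real.logb 2 n) +
          α * Real.logb 2 (Real.logb 2 (Real.logb 2 n)) + γ := by
  have hr := rate_pos
  set K₁ : ℝ := Real.log (32 * Real.exp 4 * (12 / rate + 2)) with hK₁
  have hK₁0 : 0 ≤ K₁ := by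
    refine Real.log_nonneg ?_
    have h1 : 0 < 12 / rate := by positivity
    have h2 := Real.add_one_le_exp 4
    nlinarith
  -- `c * y` absorbs every term of the tail after the first round, since `1 / 2 ≤ y`
  set c : ℝ := 5 + (2 * K₁ + 7) / rate with hc
  set K₂ : ℝ := Real.log (32 * Real.exp 4 * (c + 2))
  refine ⟨Real.log 2 / rate, 2 + K₂ / rate + 2 * (1 + 3 + 3) * (3 / rate), fun n hn m => ?_⟩
  have : NeZero n := ⟨by omega⟩
  have hlg := three_halves_le_logb hn
  have hy := half_le_logb hlg
  set lg := Real.logb 2 n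
  set y := Real.logb 2 lg
  have hll : Real.logb d lg ≤ y := by
    have h2 : (2 : ℝ) ≤ d := by exact_mod_cast hd
    have h3 : 0 ≤ Real.log lg := Real.log_nonneg (by linarith)
    exact div_le_div_of_nonneg_left h3 (Real.log_pos (by norm_num))
      (Real.log_le_log (by norm_num) h2)
  have hloglg : Real.log lg ≤ y := log_le_logb_two (by linarith)
  -- the tail is first brought from the scale `log n` to the scale `log log n`
  have hround (m j : ℕ) : gapTail n d m (c * y * (1 + j)) ≤ (1 + 3) * Real.exp (-j) := by
    refine (gapTail_antitone m ?_).trans (gapTail_le_exp_neg (Y := lg) hd (by omega)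
      (by linarith) (by positivity) (gapTail_logb_le hd hn) m j)
    have hj0 : (0 : ℝ) ≤ j := Nat.cast_nonneg j
    have h1 : (K₁ + Real.log lg) / rate + 3 / rate * j ≤
        (2 * K₁ + 7) * y * (1 + j) / rate := by
      have h2 : (K₁ + Real.log lg) / rate + 3 / rate * j =
          (K₁ + Real.log lg + 3 * j) / rate := by ring
      rw [h2]
      gcongr
      have : K₁ ≤ K₁ * (2 * y) := le_mul_of_one_le_right hK₁0 (by linarith)
      have h4 : 0 ≤ K₁ * y * j := by positivity
      have h5 : (j : ℝ) ≤ j * (2 * y) := le_mul_of_one_le_right hj0 (by linarith)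
      have h6 : 0 ≤ y * j := by positivity
      nlinarith
    have h7 : c * y * (1 + j) = 5 * y * (1 + j) + (2 * K₁ + 7) * y * (1 + j) / rate := by
      rw [hc]
      ring
    have h8 : 0 ≤ y * j := by positivity
    rw [h7]
    linarith
  have hfinal := expectedGap_le_of_gapTail (m := m) (show 0 < 3 / rate by positivity)
    (by norm_num) (gapTail_le_exp_neg (Y := y) hd (by omega) hy (by positivity) hround m)
  refine hfinal.trans (le_of_eq ?_)
  have hlogy : Real.log y = Real.log 2 * Real.logb 2 y := by
    rw [Real.logb, mul_div_cancel₀ _ (Real.log_pos (by norm_num)).ne']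
  rw [hlogy]
  ring
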